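/- Let $H\subset\mathbb{R}^2$ be the interior of a regular hexagon of side length $1$ (in any position), and let $X,Y$ be independent random points, each uniformly distributed on $H$. Let $D=|X-Y|$ be their Euclidean distance. Then $D$ is an absolutely continuous random variable with density $$ f(d)=\frac{2}{3}d\cdot\begin{cases} \left(\frac{2}{3}-\frac{2\pi}{9\sqrt3}\right)d^2-\frac{8}{3}d+\frac{2\pi}{\sqrt3}, & 0\le d\le 1,\\[4pt] -\frac{4}{\sqrt3}\left(\frac{2d^2}{3}+1\right)\arcsin\frac{\sqrt3}{2d}+\frac{2\pi}{3\sqrt3}d^2-2\sqrt{4d^2-3}+\frac{10\pi}{3\sqrt3}, & 1\le d\le\sqrt3,\\[4pt] \frac{4}{\sqrt3}\left(\frac{d^2}{3}+4\right)\arcsin\frac{\sqrt3}{d}-\left(\frac{4\pi}{9\sqrt3}+\frac{2}{3}\right)d^2+\frac{20}{3}\sqrt{d^2-3}-\frac{16\pi}{3\sqrt3}-4, & \sqrt3\le d\le 2,\\[4pt] 0, & \text{otherwise} \end{cases} $$ (in particular $f\ge 0$), and its cumulative distribution function $F(d)=\mathbb{P}(D\le d)$ is, for every $d\in\mathbb{R}$,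 $$ F(d)=\begin{cases} 0, & d<0,\\[4pt] \frac{1}{3}\left(\frac{1}{3}-\frac{\pi}{9\sqrt3}\right)d^4-\frac{16}{27}d^3+\frac{2\pi}{3\sqrt3}d^2, & 0\le d\le 1,\\[4pt] -\frac{4}{3\sqrt3}\left(\frac{d^4}{3}+d^2\right)\arcsin\frac{\sqrt3}{2d}+\frac{\pi}{9\sqrt3}d^4+\frac{10\pi}{9\sqrt3}d^2-\frac{26d^2+3}{54}\sqrt{4d^2-3}+\frac{1}{18}, & 1\le d\le\sqrt3,\\[4pt] \frac{2}{3\sqrt3}\left(\frac{d^4}{3}+8d^2\right)\arcsin\frac{\sqrt3}{d}-\left(\frac{2\pi}{27\sqrt3}+\frac{1}{9}\right)d^4-\left(\frac{16\pi}{9\sqrt3}+\frac{4}{3}\right)d^2+\frac{14d^2+12}{9}\sqrt{d^2-3}+\frac{5}{9}, & \sqrt3\le d\le 2,\\[4pt] 1, & d>2. \end{cases} $$ At the common end points of the intervals the adjacent expressions agree. -/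

import Mathlib

open MeasureTheory ProbabilityTheory

noncomputable section

/-- The vertices of the regular hexagon with side length `1` (equivalently, circumradius `1`),
centre `c`, and one vertex in the direction of angle `θ`. -/
def hexagonVertex (c : EuclideanSpace ℝ (Fin 2)) (θ : ℝ) (k : Fin 6) :
    EuclideanSpace ℝ (Fin 2) :=
  c + !₂[Real.cos (θ + ((k : ℕ) : ℝ) * (Real.pi / 3)),
         Real.sin (θ + ((k : ℕ) : ℝ) * (Real.pi / 3))]

/-- The (open) unit hexagon: the interior of the convex hull of its six vertices. -/
def unitHexagon (c : EuclideanSpace ℝ (Fin 2)) (θ : ℝ) : Set (EuclideanSpace ℝ (Fin 2)) :=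
  interior (convexHull ℝ (Set.range (hexagonVertex c θ)))

/-- First piece of the density, for `0 ≤ d ≤ 1`. -/
def hexPDF₁ (d : ℝ) : ℝ :=
  2 / 3 * d * ((2 / 3 - 2 * Real.pi / (9 * √3)) * d ^ 2 - 8 / 3 * d + 2 * Real.pi / √3)

/-- Second piece of the density, for `1 ≤ d ≤ √3`. -/
def hexPDF₂ (d : ℝ) : ℝ :=
  2 / 3 * d * (-(4 / √3) * (2 * d ^ 2 / 3 + 1) * Real.arcsin (√3 / (2 * d))
    + 2 * Real.pi / (3 * √3) * d ^ 2 - 2 * √(4 * d ^ 2 - 3) + 10 * Real.pi / (3 * √3))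

/-- Third piece of the density, for `√3 ≤ d ≤ 2`. -/
def hexPDF₃ (d : ℝ) : ℝ :=
  2 / 3 * d * (4 / √3 * (d ^ 2 / 3 + 4) * Real.arcsin (√3 / d)
    - (4 * Real.pi / (9 * √3) + 2 / 3) * d ^ 2 + 20 / 3 * √(d ^ 2 - 3)
    - 16 * Real.pi / (3 * √3) - 4)

/-- The density of the distance. Adjacent pieces agree at the common end points, see below. -/
def hexPDF (d : ℝ) : ℝ :=
  if d < 0 then 0
  else if d ≤ 1 then hexPDF₁ d
  else if d ≤ √3 then hexPDF₂ d
  else if d ≤ 2 then hexPDF₃ d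
  else 0

/-- First piece of the distribution function, for `0 ≤ d ≤ 1`. -/
def hexCDF₁ (d : ℝ) : ℝ :=
  1 / 3 * (1 / 3 - Real.pi / (9 * √3)) * d ^ 4 - 16 / 27 * d ^ 3
    + 2 * Real.pi / (3 * √3) * d ^ 2

/-- Second piece of the distribution function, for `1 ≤ d ≤ √3`. -/
def hexCDF₂ (d : ℝ) : ℝ :=
  -(4 / (3 * √3)) * (d ^ 4 / 3 + d ^ 2) * Real.arcsin (√3 / (2 * d))
    + Real.pi / (9 * √3) * d ^ 4 + 10 * Real.pi / (9 * √3) * d ^ 2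
    - (26 * d ^ 2 + 3) / 54 * √(4 * d ^ 2 - 3) + 1 / 18

/-- Third piece of the distribution function, for `√3 ≤ d ≤ 2`. -/
def hexCDF₃ (d : ℝ) : ℝ :=
  2 / (3 * √3) * (d ^ 4 / 3 + 8 * d ^ 2) * Real.arcsin (√3 / d)
    - (2 * Real.pi / (27 * √3) + 1 / 9) * d ^ 4
    - (16 * Real.pi / (9 * √3) + 4 / 3) * d ^ 2
    + (14 * d ^ 2 + 12) / 9 * √(d ^ 2 - 3) + 5 / 9

/-- The cumulative distribution function of the distance. -/
def hexCDF (d : ℝ) : ℝ :=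
  if d < 0 then 0
  else if d ≤ 1 then hexCDF₁ d
  else if d ≤ √3 then hexCDF₂ d
  else if d ≤ 2 then hexCDF₃ d
  else 1

theorem arcsin_sqrt_three_div_two : Real.arcsin (√3 / 2) = Real.pi / 3 := by
  rw [← Real.sin_pi_div_three]
  exact Real.arcsin_sin (by linarith [Real.pi_pos]) (by linarith [Real.pi_pos])

theorem arcsin_sqrt_three_div_two_mul :
    Real.arcsin (√3 / (2 * √3)) = Real.pi / 6 := by
  have h : √3 / (2 * √3) = Real.sin (Real.pi / 6) := by
    have : √3 ≠ 0 := by positivity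
    rw [Real.sin_pi_div_six]; field_simp
  rw [h]
  exact Real.arcsin_sin (by linarith [Real.pi_pos]) (by linarith [Real.pi_pos])

/-- The pieces of the density agree at the common end points of their intervals. -/
theorem hexPDF_pieces_agree :
    hexPDF₁ 0 = 0 ∧ hexPDF₁ 1 = hexPDF₂ 1 ∧ hexPDF₂ √3 = hexPDF₃ √3 ∧ hexPDF₃ 2 = 0 := by
  have h3 : √3 ≠ 0 := by positivity
  have hs : √(3 : ℝ) ^ 2 = 3 := Real.sq_sqrt (by norm_num)
  have h9 : √(9 : ℝ) = 3 := by
    rw [show (9 : ℝ) = 3 ^ 2 by norm_num]; exact Real.sqrt_sq (by norm_num)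
  refine ⟨by simp [hexPDF₁], ?_, ?_, ?_⟩
  · have h1 : √(4 * (1 : ℝ) ^ 2 - 3) = 1 := by norm_num
    unfold hexPDF₁ hexPDF₂
    rw [h1, mul_one 2, arcsin_sqrt_three_div_two]
    field_simp
    ring
  · have h1 : √(4 * (√(3 : ℝ)) ^ 2 - 3) = 3 := by rw [hs, ← h9]; norm_num
    have h2 : √((√(3 : ℝ)) ^ 2 - 3) = 0 := by rw [hs]; norm_num
    unfold hexPDF₂ hexPDF₃
    rw [h1, h2, arcsin_sqrt_three_div_two_mul, div_self h3, Real.arcsin_one, hs]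
    field_simp
    ring
  · have h1 : √((2 : ℝ) ^ 2 - 3) = 1 := by norm_num
    unfold hexPDF₃
    rw [h1, arcsin_sqrt_three_div_two]
    field_simp
    ring

/-- The pieces of the distribution function agree at the common end points. -/
theorem hexCDF_pieces_agree :
    hexCDF₁ 0 = 0 ∧ hexCDF₁ 1 = hexCDF₂ 1 ∧ hexCDF₂ √3 = hexCDF₃ √3 ∧ hexCDF₃ 2 = 1 := by
  have h3 : √3 ≠ 0 := by positivity
  have hs : √(3 : ℝ) ^ 2 = 3 := Real.sq_sqrt (by norm_num)
  have hs4 : √(3 : ℝ) ^ 4 = 9 := by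
    rw [show √(3 : ℝ) ^ 4 = (√(3 : ℝ) ^ 2) ^ 2 by ring, hs]; norm_num
  have h9 : √(9 : ℝ) = 3 := by
    rw [show (9 : ℝ) = 3 ^ 2 by norm_num]; exact Real.sqrt_sq (by norm_num)
  refine ⟨by simp [hexCDF₁], ?_, ?_, ?_⟩
  · have h1 : √(4 * (1 : ℝ) ^ 2 - 3) = 1 := by norm_num
    unfold hexCDF₁ hexCDF₂
    rw [h1, mul_one 2, arcsin_sqrt_three_div_two]
    field_simp
    ring
  · have h1 : √(4 * (√(3 : ℝ)) ^ 2 - 3) = 3 := by rw [hs, ← h9]; norm_num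
    have h2 : √((√(3 : ℝ)) ^ 2 - 3) = 0 := by rw [hs]; norm_num
    unfold hexCDF₂ hexCDF₃
    rw [h1, h2, arcsin_sqrt_three_div_two_mul, div_self h3, Real.arcsin_one, hs, hs4]
    field_simp
    ring
  · have h1 : √((2 : ℝ) ^ 2 - 3) = 1 := by norm_num
    unfold hexCDF₃
    rw [h1, arcsin_sqrt_three_div_two]
    field_simp
    ring

end

/-! The difference of two independent uniform points of a set `S` has density `covariogram S /
|S|^2`, where the covariogram at `v` is the area of `S ∩ (S - v)`; this is Fubini plus a translation
(`setLIntegral_prod_sub`). Covariograms are carried along by isometries and depend on the set only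
up to null sets, so the hexagon may be taken closed, centred at 0 in `ℂ`, with the sixth roots of
unity as vertices.

The distance density at `r` is therefore `r / |S|^2` times the integral of the covariogram over the
directions `φ`. The covariogram inherits the twelvefold dihedral symmetry of the hexagon, so only
the sector `π/6 ≤ φ ≤ π/3` matters. There, for a translation `a + b e^{iπ/3}` with `0 ≤ a ≤ b`, the
intersection has an explicit piecewise quadratic area (`covariogram_complexHexagon`): a
parallelogram less two corner triangles, which disappear once `b ≥ 1`; it has area zero once `a + b
≥ 2`.

In polar form these quadratics have elementary antiderivatives. The directions where `b = 1` or `a +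
b = 2` enter as limits of integration and produce the two arcsines; the radii `1`, `√3`, `2` are
where such a direction enters or leaves the sector. This gives `hexPDF_eq`. The distribution
function follows by differentiating the claimed formula, which is continuous and has derivative
`hexPDF` off four points (`integral_hexPDF`). -/

/-! ### The model hexagon in `ℂ`: three strips and six vertices. -/

/-- The closed regular hexagon in `ℂ` whose vertices are the sixth roots of unity. -/
def complexHexagon : Set ℂ :=
  {z | |z.im| ≤ √3 / 2 ∧ |√3 * z.re + z.im| ≤ √3 ∧ |√3 * z.re - z.im| ≤ √3}

theorem sq_sqrt_three : √3 * √3 = (3 : ℝ) := Real.mul_self_sqrt (by norm_num)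

theorem convex_complexHexagon : Convex ℝ complexHexagon := by
  have key : ∀ p q : ℝ, ∀ f : ℂ →ₗ[ℝ] ℝ, (∀ z, f z = p * z.re + q * z.im) → ∀ r,
      Convex ℝ {z : ℂ | |p * z.re + q * z.im| ≤ r} := by
    intro p q f hf r
    have : {z : ℂ | |p * z.re + q * z.im| ≤ r} = f ⁻¹' Set.Icc (-r) r := by
      ext z
      simp [hf, abs_le]
    rw [this]
    exact (convex_Icc _ _).linear_preimage f
  have h1 := key 0 1 Complex.imLm (by simp) (√3 / 2)
  have h2 := key √3 1 (√3 • Complex.reLm + Complex.imLm) (by simp) √3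
  have h3 := key √3 (-1) (√3 • Complex.reLm - Complex.imLm) (by simp [sub_eq_add_neg]) √3
  have := (h1.inter h2).inter h3
  convert this using 1
  ext z
  simp [complexHexagon, sub_eq_add_neg, and_assoc]

theorem isClosed_complexHexagon : IsClosed complexHexagon := by
  have h1 : IsClosed {z : ℂ | |z.im| ≤ √3 / 2} := isClosed_le (by fun_prop) (by fun_prop)
  have h2 : IsClosed {z : ℂ | |√3 * z.re + z.im| ≤ √3} := isClosed_le (by fun_prop) (by fun_prop)
  have h3 : IsClosed {z : ℂ | |√3 * z.re - z.im| ≤ √3} := isClosed_le (by fun_prop) (by fun_prop)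
  exact h1.inter (h2.inter h3)

theorem measurableSet_complexHexagon : MeasurableSet complexHexagon :=
  isClosed_complexHexagon.measurableSet

/-- The sixth roots of unity. -/
noncomputable def sixthRoot (k : Fin 6) : ℂ :=
  ⟨Real.cos (((k : ℕ) : ℝ) * (Real.pi / 3)), Real.sin (((k : ℕ) : ℝ) * (Real.pi / 3))⟩

theorem sixthRoot_eq : sixthRoot 0 = ⟨1, 0⟩ ∧ sixthRoot 1 = ⟨1 / 2, √3 / 2⟩ ∧
    sixthRoot 2 = ⟨-1 / 2, √3 / 2⟩ ∧ sixthRoot 3 = ⟨-1, 0⟩ ∧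
    sixthRoot 4 = ⟨-1 / 2, -(√3 / 2)⟩ ∧ sixthRoot 5 = ⟨1 / 2, -(√3 / 2)⟩ := by
  have e2 : (2 : ℝ) * (Real.pi / 3) = Real.pi - Real.pi / 3 := by ring
  have e3 : (3 : ℝ) * (Real.pi / 3) = Real.pi := by ring
  have e4 : (4 : ℝ) * (Real.pi / 3) = Real.pi / 3 + Real.pi := by ring
  have e5 : (5 : ℝ) * (Real.pi / 3) = 2 * Real.pi - Real.pi / 3 := by ring
  refine ⟨?_, ?_, ?_, ?_, ?_, ?_⟩ <;> apply Complex.ext <;> simp [sixthRoot, e2, e3, e4, e5] <;>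
    ring

/-- The vertices satisfy the strip inequalities, and the strips are convex. Conversely, each
horizontal chord of the hexagon has its end points on edges, hence in the hull. -/
theorem convexHull_range_sixthRoot : convexHull ℝ (Set.range sixthRoot) = complexHexagon := by
  obtain ⟨h0, h1, h2, h3, h4, h5⟩ := sixthRoot_eq
  have hs := sq_sqrt_three
  have hp : 0 < √(3 : ℝ) := by positivity
  apply subset_antisymm
  · apply convexHull_min _ convex_complexHexagon
    rintro _ ⟨k, rfl⟩
    fin_cases k <;> simp only [Fin.zero_eta, Fin.mk_one, Fin.reduceFinMk, h0, h1, h2, h3, h4, h5,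
      complexHexagon, Set.mem_ofPred_eq, abs_le] <;> refine ⟨⟨?_, ?_⟩, ⟨?_, ?_⟩, ?_, ?_⟩ <;> linarith
  · have hC := convex_convexHull ℝ (Set.range sixthRoot)
    have hv : ∀ k, sixthRoot k ∈ convexHull ℝ (Set.range sixthRoot) := fun k =>
      subset_convexHull ℝ _ ⟨k, rfl⟩
    have v0 := hv 0
    have v1 := hv 1
    have v2 := hv 2
    have v3 := hv 3
    have v4 := hv 4
    have v5 := hv 5
    rw [h0] at v0; rw [h1] at v1; rw [h2] at v2; rw [h3] at v3; rw [h4] at v4; rw [h5] at v5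
    -- Here `l` is the height as a fraction of the half-height. The chord at that height runs from
    -- `-(1 - l / 2)` to `1 - l / 2`, its ends lying on the edges from `±1` to `(±1/2, s)`; `s =
    -- ±√3/2` gives the upper and lower halves.
    have key : ∀ l t : ℝ, 0 ≤ l → l ≤ 1 → |t| ≤ 1 - l / 2 → ∀ s : ℝ,
        (⟨1 / 2, s⟩ : ℂ) ∈ convexHull ℝ (Set.range sixthRoot) →
        (⟨-1 / 2, s⟩ : ℂ) ∈ convexHull ℝ (Set.range sixthRoot) →
        (⟨t, l * s⟩ : ℂ) ∈ convexHull ℝ (Set.range sixthRoot) := by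
      intro l t hl0 hl1 ht s hs1 hs2
      have hR := hC v0 hs1 (sub_nonneg.2 hl1) hl0 (by ring)
      have hL := hC v3 hs2 (sub_nonneg.2 hl1) hl0 (by ring)
      have hm : 0 < 1 - l / 2 := by linarith
      rw [abs_le] at ht
      have hq1 : 0 ≤ (1 + t / (1 - l / 2)) / 2 := by
        have : -1 ≤ t / (1 - l / 2) := by rw [le_div_iff₀ hm]; linarith
        linarith
      have hq2 : 0 ≤ (1 - t / (1 - l / 2)) / 2 := by
        have : t / (1 - l / 2) ≤ 1 := by rw [div_le_iff₀ hm]; linarith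
        linarith
      have := hC hR hL hq1 hq2 (by ring)
      convert this using 1
      have hq : t = t / (1 - l / 2) * (1 - l / 2) := (div_mul_cancel₀ t hm.ne').symm
      generalize t / (1 - l / 2) = q at hq ⊢
      apply Complex.ext
      · simp only [hq, Complex.add_re, Complex.real_smul, Complex.re_ofReal_mul]
        ring
      · simp only [Complex.add_im, Complex.real_smul, Complex.im_ofReal_mul]
        ring
    rintro z ⟨hz1, hz2, hz3⟩
    rw [abs_le] at hz1 hz2 hz3
    obtain ⟨x, y⟩ := z
    dsimp only at hz1 hz2 hz3
    have hd : ∀ u : ℝ, |√3 * x| ≤ √3 - u → |x| ≤ 1 - 2 * u / √3 / 2 := by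
      intro u hu
      rw [abs_mul, abs_of_pos hp] at hu
      have : |x| ≤ (√3 - u) / √3 := by rw [le_div_iff₀ hp]; linarith
      refine this.trans (le_of_eq ?_)
      field_simp
    rcases le_total 0 y with hy | hy
    · have := key (2 * y / √3) x (by positivity) (by rw [div_le_one hp]; linarith)
        (hd y (by rw [abs_le]; constructor <;> linarith)) _ v1 v2
      convert this using 2
      field_simp
    · have := key (2 * (-y) / √3) x (div_nonneg (by linarith) hp.le)
        (by rw [div_le_one hp]; linarith)
        (hd (-y) (by rw [abs_le]; constructor <;> linarith)) _ v5 v4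
      convert this using 2
      field_simp

/-! ### Moving the model hexagon to an arbitrary position. -/

/-- The isometry from `ℂ` onto the Euclidean plane that rotates by the angle `θ`. -/
noncomputable def planeRotation (θ : ℝ) : ℂ ≃ₗᵢ[ℝ] EuclideanSpace ℝ (Fin 2) :=
  (rotation (Circle.exp θ)).trans Complex.orthonormalBasisOneI.repr

theorem planeRotation_sixthRoot (c : EuclideanSpace ℝ (Fin 2)) (θ : ℝ) (k : Fin 6) :
    c + planeRotation θ (sixthRoot k) = hexagonVertex c θ k := by
  unfold hexagonVertex planeRotation sixthRoot
  congr 1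
  ext i
  fin_cases i
  · simp [Complex.exp_ofReal_mul_I_re, Complex.exp_ofReal_mul_I_im, Real.cos_add]
  · simp [Complex.exp_ofReal_mul_I_re, Complex.exp_ofReal_mul_I_im, Real.sin_add]
    ring

/-- Affine maps commute with convex hulls, and the frontier of a convex set is null, so passing to
the interior costs nothing. -/
theorem unitHexagon_ae_eq (c : EuclideanSpace ℝ (Fin 2)) (θ : ℝ) :
    unitHexagon c θ =ᵐ[volume] (fun z => c + planeRotation θ z) '' complexHexagon := by
  let T : ℂ →ᵃ[ℝ] EuclideanSpace ℝ (Fin 2) :=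
    AffineMap.const ℝ ℂ c + (planeRotation θ).toLinearEquiv.toLinearMap.toAffineMap
  have hT : (T : ℂ → EuclideanSpace ℝ (Fin 2)) = fun z => c + planeRotation θ z := rfl
  have h : convexHull ℝ (Set.range (hexagonVertex c θ)) =
      (fun z => c + planeRotation θ z) '' complexHexagon := by
    rw [← convexHull_range_sixthRoot, ← hT, AffineMap.image_convexHull, ← Set.range_comp]
    congr 2
    funext k
    exact (planeRotation_sixthRoot c θ k).symm
  rw [← h]
  exact interior_ae_eq_of_null_frontier ((convex_convexHull ℝ _).addHaar_frontier _)

/-! ### Covariograms and the law of a difference. -/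

/-- The set covariance (covariogram) of `S` at `v`. -/
noncomputable def covariogram {G : Type*} [AddGroup G] [MeasureSpace G] (S : Set G) (v : G) :
    ENNReal :=
  volume {y | y ∈ S ∧ v + y ∈ S}

theorem measurable_covariogram {G : Type*} [AddGroup G] [MeasureSpace G] [MeasurableAdd₂ G]
    [SFinite (volume : Measure G)] {S : Set G} (hS : MeasurableSet S) :
    Measurable (covariogram S) := by
  have : MeasurableSet {p : G × G | p.2 ∈ S ∧ p.1 + p.2 ∈ S} :=
    (measurable_snd hS).inter (measurable_add hS)
  exact measurable_measure_prodMk_left this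

/-- Substitute `x = v + y` for fixed `y`, then exchange the integrals: the inner integral over `y`
measures the pairs in `S` with difference `v`. -/
theorem setLIntegral_prod_sub {G : Type*} [AddCommGroup G] [MeasureSpace G]
    [MeasurableAdd₂ G] [MeasurableSub₂ G] [SFinite (volume : Measure G)]
    [(volume : Measure G).IsAddRightInvariant] {S : Set G} (hS : MeasurableSet S) {f : G → ENNReal}
    (hf : Measurable f) :
    ∫⁻ p in S ×ˢ S, f (p.1 - p.2) ∂((volume : Measure G).prod volume) =
      ∫⁻ v, f v * covariogram S v := by
  have hi : Measurable (S.indicator (1 : G → ENNReal)) := measurable_one.indicator hS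
  have hm : Measurable fun p : G × G =>
      f (p.1 - p.2) * (S.indicator 1 p.2 * S.indicator 1 p.1) :=
    (hf.comp measurable_sub).mul ((hi.comp measurable_snd).mul (hi.comp measurable_fst))
  have hm' : Measurable fun p : G × G =>
      f p.2 * (S.indicator 1 p.1 * S.indicator 1 (p.2 + p.1)) :=
    (hf.comp measurable_snd).mul ((hi.comp measurable_fst).mul
      (hi.comp (measurable_snd.add measurable_fst)))
  rw [← lintegral_indicator (hS.prod hS)]
  calc ∫⁻ p, (S ×ˢ S).indicator (fun p => f (p.1 - p.2)) p ∂((volume : Measure G).prod volume)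
      = ∫⁻ p, f (p.1 - p.2) * (S.indicator 1 p.2 * S.indicator 1 p.1)
          ∂((volume : Measure G).prod volume) := by
        refine lintegral_congr fun p => ?_
        by_cases h1 : p.1 ∈ S <;> by_cases h2 : p.2 ∈ S <;> simp [h1, h2, Set.indicator]
    _ = ∫⁻ y, ∫⁻ x, f (x - y) * (S.indicator 1 y * S.indicator 1 x) := by
        rw [lintegral_prod_symm _ hm.aemeasurable]
    _ = ∫⁻ y, ∫⁻ v, f v * (S.indicator 1 y * S.indicator 1 (v + y)) := by
        refine lintegral_congr fun y => ?_
        rw [← lintegral_add_right_eq_self _ y]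
        simp
    _ = ∫⁻ v, ∫⁻ y, f v * (S.indicator 1 y * S.indicator 1 (v + y)) :=
        lintegral_lintegral_swap hm'.aemeasurable
    _ = ∫⁻ v, f v * covariogram S v := by
        refine lintegral_congr fun v => ?_
        have hv : Measurable fun y => S.indicator (1 : G → ENNReal) y * S.indicator 1 (v + y) :=
          hi.mul (hi.comp (measurable_const_add v))
        rw [lintegral_const_mul _ hv]
        congr 1
        have : MeasurableSet {y | y ∈ S ∧ v + y ∈ S} := hS.inter (measurable_const_add v hS)
        rw [covariogram, ← lintegral_indicator_one this]
        refine lintegral_congr fun y => ?_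
        by_cases h1 : y ∈ S <;> by_cases h2 : v + y ∈ S <;> simp [h1, h2, Set.indicator]

theorem covariogram_image_isometry {E F : Type*} [NormedAddCommGroup E] [InnerProductSpace ℝ E]
    [NormedAddCommGroup F] [InnerProductSpace ℝ F] [MeasurableSpace E] [BorelSpace E]
    [MeasurableSpace F] [BorelSpace F] [FiniteDimensional ℝ E] [FiniteDimensional ℝ F]
    (U : E ≃ₗᵢ[ℝ] F) (c : F) (S : Set E) (v : E) :
    covariogram ((fun z => c + U z) '' S) (U v) = covariogram S v := by
  unfold covariogram
  have hmem : ∀ y, c + U y ∈ (fun z => c + U z) '' S ↔ y ∈ S := fun y =>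
    Function.Injective.mem_set_image fun a b h => by simpa using h
  rw [← measure_preimage_add volume c, ← U.measurePreserving.measure_preimage_emb
    U.toMeasurableEquiv.measurableEmbedding]
  congr 1
  ext y
  have : U v + (c + U y) = c + U (v + y) := by rw [map_add]; abel
  simp only [Set.mem_preimage, Set.mem_ofPred_eq, this, hmem]

theorem covariogram_eq_of_map_mem_iff (U : ℂ ≃ₗᵢ[ℝ] ℂ) {S : Set ℂ} (h : ∀ z, U z ∈ S ↔ z ∈ S)
    (v : ℂ) : covariogram S (U v) = covariogram S v := by
  have hS : (fun z => 0 + U z) '' S = S := by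
    ext w
    obtain ⟨z, rfl⟩ := U.surjective w
    simp [h]
  conv_lhs => rw [← hS]
  exact covariogram_image_isometry U 0 S v

/-! ### Dihedral symmetry of the hexagon's covariogram. -/

theorem covariogram_complexHexagon_conj (z : ℂ) :
    covariogram complexHexagon (starRingEnd ℂ z) = covariogram complexHexagon z := by
  refine covariogram_eq_of_map_mem_iff Complex.conjLIE (fun z => ?_) z
  simp only [complexHexagon, Complex.conjLIE_apply, Set.mem_ofPred_eq, Complex.conj_im,
    Complex.conj_re, abs_neg, sub_neg_eq_add, ← sub_eq_add_neg]
  tauto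

/-- Rotation by `π/3` permutes the three strips cyclically; `e1`, `e2`, `e3` record which strip each
one becomes. -/
theorem covariogram_complexHexagon_rotate (z : ℂ) :
    covariogram complexHexagon (Circle.exp (Real.pi / 3) * z) =
      covariogram complexHexagon z := by
  refine covariogram_eq_of_map_mem_iff (rotation (Circle.exp (Real.pi / 3))) (fun z => ?_) z
  have hs := sq_sqrt_three
  have hre : (Complex.exp (↑(Real.pi / 3) * Complex.I)).re = 1 / 2 := by
    rw [Complex.exp_ofReal_mul_I_re, Real.cos_pi_div_three]
  have him : (Complex.exp (↑(Real.pi / 3) * Complex.I)).im = √3 / 2 := by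
    rw [Complex.exp_ofReal_mul_I_im, Real.sin_pi_div_three]
  simp only [complexHexagon, rotation_apply, Circle.coe_exp, Set.mem_ofPred_eq, Complex.mul_re,
    Complex.mul_im, hre, him]
  have e1 : 1 / 2 * z.im + √3 / 2 * z.re = (√3 * z.re + z.im) / 2 := by ring
  have e2 : √3 * (1 / 2 * z.re - √3 / 2 * z.im) + (√3 * z.re + z.im) / 2 =
      √3 * z.re - z.im := by linear_combination (-z.im / 2) * hs
  have e3 : √3 * (1 / 2 * z.re - √3 / 2 * z.im) - (√3 * z.re + z.im) / 2 = -2 * z.im := by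
    linear_combination (-z.im / 2) * hs
  rw [e1, e2, e3]
  simp only [abs_le]
  constructor <;> rintro ⟨⟨_, _⟩, ⟨_, _⟩, _, _⟩ <;>
    refine ⟨⟨?_, ?_⟩, ⟨?_, ?_⟩, ?_, ?_⟩ <;> linarith

/-! ### Area of the intersection of the hexagon with a translate. -/

theorem integral_max_zero (p q : ℝ) :
    ∫ y in p..q, max 0 y = (max 0 q) ^ 2 / 2 - (max 0 p) ^ 2 / 2 := by
  refine integral_eq_of_hasDerivAt_off_countable (fun y => (max 0 y) ^ 2 / 2) (fun y => max 0 y)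
    (Set.countable_singleton (0 : ℝ)) (by fun_prop) ?_
    (Continuous.intervalIntegrable (by fun_prop) _ _)
  rintro y ⟨-, hy⟩
  rcases lt_or_gt_of_ne hy with h | h
  · have : HasDerivAt (fun _ : ℝ => (0 : ℝ)) (max 0 y) y := by
      rw [max_eq_left h.le]; exact hasDerivAt_const _ _
    refine this.congr_of_eventuallyEq ?_
    filter_upwards [eventually_lt_nhds h] with w hw
    simp [max_eq_left hw.le]
  · have : HasDerivAt (fun w : ℝ => w ^ 2 / 2) (max 0 y) y := by
      rw [max_eq_right h.le]
      refine ((hasDerivAt_pow 2 y).div_const 2).congr_deriv ?_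
      simp
    refine this.congr_of_eventuallyEq ?_
    filter_upwards [eventually_gt_nhds h] with w hw
    simp [max_eq_right hw.le]

/-- The area of the intersection of the hexagon with its translate, in oblique coordinates and up
to the factor `√3 / 2`, for translations in the sector `0 ≤ a ≤ b`. -/
noncomputable def sectorArea (a b : ℝ) : ℝ :=
  if a + b ≤ 2 then (2 - b) * (2 - a - b) - (max 0 (1 - b)) ^ 2 else 0

/-- The translation is `a + b e^{iπ/3}`. The area is computed by horizontal slices: at height
`(√3/2) y` the slice is an interval of length `l y`, and only `-1 ≤ y ≤ 1 - b` contributes. -/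
theorem covariogram_complexHexagon {a b : ℝ} (ha : 0 ≤ a) (hab : a ≤ b) :
    covariogram complexHexagon ⟨a + b / 2, √3 / 2 * b⟩ =
      ENNReal.ofReal (√3 / 2 * sectorArea a b) := by
  have hp : 0 < √(3 : ℝ) := by positivity
  have hh : 0 < √(3 : ℝ) / 2 := by positivity
  have hb : 0 ≤ b := ha.trans hab
  have hmeas : MeasurableSet {w : ℂ | w ∈ complexHexagon ∧
      (⟨a + b / 2, √3 / 2 * b⟩ : ℂ) + w ∈ complexHexagon} :=
    measurableSet_complexHexagon.inter (measurable_const_add _ measurableSet_complexHexagon)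
  set l : ℝ → ℝ := fun y => 2 - a - b - max 0 (-b - y) - max 0 y with hl
  have hlc : Continuous l := by fun_prop
  have hslice : ∀ t : ℝ, volume {x : ℝ | (⟨x, t⟩ : ℂ) ∈ complexHexagon ∧
      (⟨a + b / 2, √3 / 2 * b⟩ : ℂ) + ⟨x, t⟩ ∈ complexHexagon} =
      (Set.Icc (-(√3 / 2)) (√3 / 2 - √3 / 2 * b)).indicator
        (fun t => ENNReal.ofReal (l (t / (√3 / 2)))) t := by
    intro t
    obtain ⟨y, rfl⟩ : ∃ y, t = √3 / 2 * y := ⟨t / (√3 / 2), by field_simp⟩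
    have hy : √3 / 2 * y / (√3 / 2) = y := by field_simp
    have habs : ∀ u : ℝ, |√3 * u| ≤ √3 ↔ |u| ≤ 1 := by
      intro u
      rw [abs_mul, abs_of_pos hp]
      exact mul_le_iff_le_one_right hp
    have hset : {x : ℝ | (⟨x, √3 / 2 * y⟩ : ℂ) ∈ complexHexagon ∧
        (⟨a + b / 2, √3 / 2 * b⟩ : ℂ) + ⟨x, √3 / 2 * y⟩ ∈ complexHexagon} =
        {x : ℝ | √3 / 2 * y ∈ Set.Icc (-(√3 / 2)) (√3 / 2 - √3 / 2 * b) ∧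
          x ∈ Set.Icc (max (-1 - y / 2) (-1 + y / 2))
            (min (1 - a - b - y / 2) (1 - a + y / 2))} := by
      ext x
      simp only [complexHexagon, Set.mem_ofPred_eq, Complex.add_re, Complex.add_im, Set.mem_Icc,
        max_le_iff, le_min_iff]
      have e1 : √3 * x + √3 / 2 * y = √3 * (x + y / 2) := by ring
      have e2 : √3 * x - √3 / 2 * y = √3 * (x - y / 2) := by ring
      have e3 : √3 * (a + b / 2 + x) + (√3 / 2 * b + √3 / 2 * y) =
        √3 * (x + y / 2 + a + b) := by ring
      have e4 : √3 * (a + b / 2 + x) - (√3 / 2 * b + √3 / 2 * y) =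
        √3 * (x - y / 2 + a) := by ring
      have hbb : 0 ≤ √3 / 2 * b := by positivity
      rw [e1, e2, e3, e4]
      simp only [habs, abs_le]
      constructor
      · rintro ⟨⟨⟨_, _⟩, ⟨_, _⟩, _, _⟩, ⟨_, _⟩, ⟨_, _⟩, _, _⟩
        refine ⟨⟨?_, ?_⟩, ⟨?_, ?_⟩, ?_, ?_⟩ <;> linarith
      · rintro ⟨⟨_, _⟩, ⟨_, _⟩, _, _⟩
        refine ⟨⟨⟨?_, ?_⟩, ⟨?_, ?_⟩, ?_, ?_⟩, ⟨?_, ?_⟩, ⟨?_, ?_⟩, ?_, ?_⟩ <;> linarith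
    rw [hset]
    by_cases ht : √3 / 2 * y ∈ Set.Icc (-(√3 / 2)) (√3 / 2 - √3 / 2 * b)
    · simp only [ht, true_and, Set.indicator_of_mem, Set.ofPred_mem_eq, Real.volume_Icc, hy]
      congr 1
      have e1 : min (1 - a - b - y / 2) (1 - a + y / 2) =
          1 - a - b - y / 2 - max 0 (-b - y) := by
        rcases le_total (-b - y) 0 with h | h
        · rw [max_eq_left h, min_eq_left (by linarith)]; ring
        · rw [max_eq_right h, min_eq_right (by linarith)]; ring
      have e2 : max (-1 - y / 2) (-1 + y / 2) = -1 - y / 2 + max 0 y := by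
        rcases le_total y 0 with h | h
        · rw [max_eq_left h, max_eq_left (by linarith)]; ring
        · rw [max_eq_right h, max_eq_right (by linarith)]; ring
      rw [e1, e2, hl]
      ring
    · simp [ht]
  have hvol : covariogram complexHexagon ⟨a + b / 2, √3 / 2 * b⟩ =
      ∫⁻ t in Set.Icc (-(√3 / 2)) (√3 / 2 - √3 / 2 * b),
        ENNReal.ofReal (l (t / (√3 / 2))) := by
    rw [covariogram, ← Complex.volume_preserving_equiv_real_prod.symm.measure_preimage_equiv,
      Measure.volume_eq_prod, Measure.prod_apply_symm
        (Complex.measurableEquivRealProd.symm.measurable hmeas),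
      ← lintegral_indicator measurableSet_Icc]
    exact lintegral_congr fun t => hslice t
  rw [hvol, sectorArea]
  have hyIcc : ∀ t ∈ Set.Icc (-(√3 / 2)) (√3 / 2 - √3 / 2 * b),
      -1 ≤ t / (√3 / 2) ∧ t / (√3 / 2) ≤ 1 - b := by
    rintro t ⟨h1, h2⟩
    rw [le_div_iff₀ hh, div_le_iff₀ hh]
    constructor <;> linarith
  split_ifs with h2
  -- From `a ≤ b` and `a + b ≤ 2` one gets `a ≤ 1`, which keeps the slice lengths nonnegative up to
  -- both ends.
  · have hnn : ∀ t ∈ Set.Icc (-(√3 / 2)) (√3 / 2 - √3 / 2 * b), 0 ≤ l (t / (√3 / 2)) := by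
      intro t ht
      obtain ⟨h3, h4⟩ := hyIcc t ht
      simp only [hl]
      rcases le_total (-b - t / (√3 / 2)) 0 with h5 | h5 <;>
        rcases le_total (t / (√3 / 2)) 0 with h6 | h6 <;>
        simp only [h5, h6, max_eq_left, max_eq_right] <;> linarith
    have hle : -(√3 / 2) ≤ √3 / 2 - √3 / 2 * b := by nlinarith
    rw [← ofReal_integral_eq_lintegral_ofReal
      ((by fun_prop : Continuous fun t => l (t / (√3 / 2))).integrableOn_Icc)
      ((ae_restrict_iff' measurableSet_Icc).2 (.of_forall hnn)),
      integral_Icc_eq_integral_Ioc, ← intervalIntegral.integral_of_le hle,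
      intervalIntegral.integral_comp_div _ hh.ne']
    have e1 : -(√3 / 2) / (√3 / 2) = -1 := by field_simp
    have e2 : (√3 / 2 - √3 / 2 * b) / (√3 / 2) = 1 - b := by field_simp
    rw [e1, e2, smul_eq_mul]
    congr 2
    -- The reflection `y ↦ -b - y` swaps the end points `-1` and `1 - b`: the two corner triangles
    -- are congruent.
    have hi1 : ∫ y in (-1)..(1 - b), max 0 (-b - y) = ∫ y in (-1)..(1 - b), max 0 y := by
      rw [intervalIntegral.integral_comp_sub_left (fun y => max 0 y) (-b)]
      congr 1 <;> ring
    simp only [hl]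
    rw [intervalIntegral.integral_sub, intervalIntegral.integral_sub, hi1, integral_max_zero,
      intervalIntegral.integral_const]
    · simp only [smul_eq_mul]
      norm_num
      ring
    all_goals exact Continuous.intervalIntegrable (by fun_prop) _ _
  -- When `a + b > 2` every length is at most `2 - a - b < 0`, so `ENNReal.ofReal` truncates it to
  -- zero.
  · rw [mul_zero, ENNReal.ofReal_zero, setLIntegral_congr_fun (g := 0) measurableSet_Icc]
    · simp
    · intro t ht
      obtain ⟨h3, h4⟩ := hyIcc t ht
      simp only [hl, Pi.zero_apply, ENNReal.ofReal_eq_zero]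
      have := le_max_left 0 (-b - t / (√3 / 2))
      have := le_max_left 0 (t / (√3 / 2))
      linarith

/-! ### Oblique coordinates in polar form, and antiderivatives in the angle. -/

/-- The first oblique coordinate of the point with polar coordinates `(r, φ)`. -/
noncomputable def obliqueFst (r φ : ℝ) : ℝ := r * Real.cos φ - r * Real.sin φ / √3

/-- The second oblique coordinate of the point with polar coordinates `(r, φ)`. -/
noncomputable def obliqueSnd (r φ : ℝ) : ℝ := 2 * r * Real.sin φ / √3

theorem inv_sqrt_three : (√3)⁻¹ = √(3 : ℝ) / 3 := by
  have hs := sq_sqrt_three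
  field_simp
  linarith

theorem obliqueFst_add_obliqueSnd (r φ : ℝ) :
    obliqueFst r φ + obliqueSnd r φ = 2 / √3 * r * Real.sin (φ + Real.pi / 3) := by
  have hs := sq_sqrt_three
  simp only [obliqueFst, obliqueSnd, div_eq_mul_inv _ √3, inv_sqrt_three, Real.sin_add,
    Real.cos_pi_div_three, Real.sin_pi_div_three]
  linear_combination -(r * Real.cos φ / 3) * hs

theorem obliqueFst_eq (r φ : ℝ) :
    obliqueFst r φ = 2 / √3 * r * Real.sin (Real.pi / 3 - φ) := by
  have hs := sq_sqrt_three
  simp only [obliqueFst, div_eq_mul_inv _ √3, inv_sqrt_three, Real.sin_sub,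
    Real.cos_pi_div_three, Real.sin_pi_div_three]
  linear_combination -(r * Real.cos φ / 3) * hs

theorem obliqueSnd_eq (r φ : ℝ) : obliqueSnd r φ = 2 / √3 * r * Real.sin φ := by
  unfold obliqueSnd; ring

/-- The ray `φ = π/6` is `a = b` and the ray `φ = π/3` is `a = 0`. -/
theorem oblique_mem_sector {r φ : ℝ} (hr : 0 ≤ r)
    (hφ : φ ∈ Set.Icc (Real.pi / 6) (Real.pi / 3)) :
    0 ≤ obliqueFst r φ ∧ obliqueFst r φ ≤ obliqueSnd r φ := by
  have hpi := Real.pi_pos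
  obtain ⟨h1, h2⟩ := hφ
  rw [obliqueFst_eq, obliqueSnd_eq]
  constructor
  · exact mul_nonneg (by positivity) (Real.sin_nonneg_of_nonneg_of_le_pi (by linarith)
      (by linarith))
  · gcongr
    exact Real.sin_le_sin_of_le_of_le_pi_div_two (by linarith) (by linarith) (by linarith)

/-- An antiderivative of `φ ↦ (2 - b) (2 - a - b)` in polar coordinates. -/
noncomputable def sectorPrimitive (r φ : ℝ) : ℝ :=
  4 * φ + r * (2 * √3 * Real.cos φ - 2 * Real.sin φ) +
    r ^ 2 * (φ - Real.sin φ * Real.cos φ + √3 * Real.sin φ ^ 2) / 3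

/-- An antiderivative of `φ ↦ (1 - b) ^ 2` in polar coordinates. -/
noncomputable def cornerPrimitive (r φ : ℝ) : ℝ :=
  φ + 4 * r * Real.cos φ / √3 + 2 / 3 * r ^ 2 * (φ - Real.sin φ * Real.cos φ)

theorem hasDerivAt_sectorPrimitive (r φ : ℝ) : HasDerivAt (sectorPrimitive r)
    ((2 - obliqueSnd r φ) * (2 - obliqueFst r φ - obliqueSnd r φ)) φ := by
  have hs := sq_sqrt_three
  have h1 := Real.hasDerivAt_sin φ
  have h2 := Real.hasDerivAt_cos φ
  have h3 := Real.sin_sq_add_cos_sq φ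
  have := (((hasDerivAt_id φ).const_mul 4).add
    (((h2.const_mul (2 * √3)).sub (h1.const_mul 2)).const_mul r)).add
    (((((hasDerivAt_id φ).sub (h1.mul h2)).add ((h1.pow 2).const_mul √3)).const_mul
      (r ^ 2)).div_const 3)
  refine this.congr_deriv ?_
  simp only [obliqueFst, obliqueSnd, div_eq_mul_inv _ √3, inv_sqrt_three]
  push_cast
  -- What remains is a polynomial identity modulo `s² + c² = 1` and `q² = 3`.
  generalize Real.sin φ = s at *
  generalize Real.cos φ = c at *
  generalize √(3 : ℝ) = q at *
  grind

theorem hasDerivAt_cornerPrimitive (r φ : ℝ) : HasDerivAt (cornerPrimitive r)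
    ((1 - obliqueSnd r φ) ^ 2) φ := by
  have hs := sq_sqrt_three
  have h1 := Real.hasDerivAt_sin φ
  have h2 := Real.hasDerivAt_cos φ
  have h3 := Real.sin_sq_add_cos_sq φ
  have := ((hasDerivAt_id φ).add ((h2.const_mul (4 * r)).div_const √3)).add
    (((hasDerivAt_id φ).sub (h1.mul h2)).const_mul (2 / 3 * r ^ 2))
  refine this.congr_deriv ?_
  simp only [obliqueSnd, div_eq_mul_inv _ √3, inv_sqrt_three]
  generalize Real.sin φ = s at *
  generalize Real.cos φ = c at *
  generalize √(3 : ℝ) = q at *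
  grind

theorem continuous_obliqueFst (r : ℝ) : Continuous (obliqueFst r) := by
  unfold obliqueFst; fun_prop

theorem continuous_obliqueSnd (r : ℝ) : Continuous (obliqueSnd r) := by
  unfold obliqueSnd; fun_prop

theorem integral_sector (r p q : ℝ) :
    ∫ φ in p..q, (2 - obliqueSnd r φ) * (2 - obliqueFst r φ - obliqueSnd r φ) =
      sectorPrimitive r q - sectorPrimitive r p := by
  have := continuous_obliqueFst r
  have := continuous_obliqueSnd r
  exact intervalIntegral.integral_eq_sub_of_hasDerivAt
    (fun φ _ => hasDerivAt_sectorPrimitive r φ) (Continuous.intervalIntegrable (by fun_prop) _ _)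

theorem integral_corner (r p q : ℝ) :
    ∫ φ in p..q, (1 - obliqueSnd r φ) ^ 2 = cornerPrimitive r q - cornerPrimitive r p := by
  have := continuous_obliqueSnd r
  exact intervalIntegral.integral_eq_sub_of_hasDerivAt
    (fun φ _ => hasDerivAt_cornerPrimitive r φ) (Continuous.intervalIntegrable (by fun_prop) _ _)

/-! ### The angular integral reproduces the density. -/

/-- The integral of the oblique area over the directions in the sector. -/
noncomputable def sectorIntegral (r : ℝ) : ℝ :=
  ∫ φ in (Real.pi / 6)..(Real.pi / 3), sectorArea (obliqueFst r φ) (obliqueSnd r φ)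

/-- Since `a + b = (2/√3) r sin(φ + π/3)`, the bound `r ≤ √3` keeps `a + b ≤ 2` in every direction,
so the vanishing case never enters. -/
theorem sectorIntegral_eq_of_le_sqrt_three {r : ℝ} (hr : 0 ≤ r) (hr3 : r ≤ √3) :
    sectorIntegral r = sectorPrimitive r (Real.pi / 3) - sectorPrimitive r (Real.pi / 6) -
      ∫ φ in (Real.pi / 6)..(Real.pi / 3), (max 0 (1 - obliqueSnd r φ)) ^ 2 := by
  have := continuous_obliqueFst r
  have := continuous_obliqueSnd r
  rw [← integral_sector, ← intervalIntegral.integral_sub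
    (Continuous.intervalIntegrable (by fun_prop) _ _)
    (Continuous.intervalIntegrable (by fun_prop) _ _)]
  refine intervalIntegral.integral_congr fun φ _ => ?_
  have : obliqueFst r φ + obliqueSnd r φ ≤ 2 := by
    rw [obliqueFst_add_obliqueSnd]
    calc 2 / √3 * r * Real.sin (φ + Real.pi / 3) ≤ 2 / √3 * r :=
          mul_le_of_le_one_right (by positivity) (Real.sin_le_one _)
      _ ≤ 2 / √3 * √3 := by gcongr
      _ = 2 := by field_simp
  simp only [sectorArea, this, if_true]

/-- For `r ≤ 1` one has `b ≤ 1` throughout the sector, so the corner term is integrated over all of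
it. -/
theorem hexPDF₁_eq {r : ℝ} (hr : 0 ≤ r) (hr1 : r ≤ 1) :
    hexPDF₁ r = 8 * √3 / 9 * r * sectorIntegral r := by
  have hs := sq_sqrt_three
  have hpi := Real.pi_pos
  have h3 : (1 : ℝ) ≤ √3 := Real.one_le_sqrt.2 (by norm_num)
  have : ∫ φ in (Real.pi / 6)..(Real.pi / 3), (max 0 (1 - obliqueSnd r φ)) ^ 2 =
      cornerPrimitive r (Real.pi / 3) - cornerPrimitive r (Real.pi / 6) := by
    rw [← integral_corner]
    refine intervalIntegral.integral_congr fun φ hφ => ?_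
    rw [Set.uIcc_of_le (by linarith)] at hφ
    have : obliqueSnd r φ ≤ 1 := by
      rw [obliqueSnd_eq]
      calc 2 / √3 * r * Real.sin φ ≤ 2 / √3 * 1 * (√3 / 2) := by
            rw [← Real.sin_pi_div_three]
            have h1 := Real.sin_nonneg_of_nonneg_of_le_pi (x := φ) (by linarith [hφ.1])
              (by linarith [hφ.2])
            have h2 := Real.sin_le_sin_of_le_of_le_pi_div_two (by linarith [hφ.1])
              (by linarith) hφ.2
            gcongr
        _ = 1 := by field_simp
    rw [max_eq_right (by linarith)]
  rw [sectorIntegral_eq_of_le_sqrt_three hr (hr1.trans h3), this]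
  simp only [hexPDF₁, sectorPrimitive, cornerPrimitive, Real.sin_pi_div_three,
    Real.cos_pi_div_three, Real.sin_pi_div_six, Real.cos_pi_div_six]
  field_simp
  generalize √(3 : ℝ) = q at *
  grind

/-- The equation `b = 1` reads `sin φ = √3 / (2 r)`. Its solution `α` lies in the sector, and the
corner term survives only for `φ ≤ α`. -/
theorem hexPDF₂_eq {r : ℝ} (hr1 : 1 ≤ r) (hr3 : r ≤ √3) :
    hexPDF₂ r = 8 * √3 / 9 * r * sectorIntegral r := by
  have hs := sq_sqrt_three
  have hpi := Real.pi_pos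
  have hr : 0 < r := by linarith
  have h3 : 0 < √(3 : ℝ) := by positivity
  set α := Real.arcsin (√3 / (2 * r)) with hα
  have hle : √3 / (2 * r) ≤ √3 / 2 := by gcongr; linarith
  have h32 : √3 / 2 ≤ (1 : ℝ) := by nlinarith
  have h0 : 0 ≤ √3 / (2 * r) := by positivity
  have hsin : Real.sin α = √3 / (2 * r) := Real.sin_arcsin (by linarith) (by linarith)
  have hcos : Real.cos α = √(4 * r ^ 2 - 3) / (2 * r) := by
    have hx : 1 - (√3 / (2 * r)) ^ 2 = (4 * r ^ 2 - 3) / (2 * r) ^ 2 := by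
      field_simp
      generalize √(3 : ℝ) = q at *
      grind
    rw [hα, Real.cos_arcsin, hx, Real.sqrt_div' _ (sq_nonneg _), Real.sqrt_sq (by positivity)]
  have hα1 : Real.pi / 6 ≤ α := by
    rw [Real.le_arcsin_iff_sin_le' ⟨by linarith, by linarith⟩, Real.sin_pi_div_six,
      div_le_div_iff₀ (by norm_num) (by positivity)]
    linarith
  have hα2 : α ≤ Real.pi / 3 := by
    rw [← arcsin_sqrt_three_div_two]
    exact Real.monotone_arcsin hle
  have hcont := continuous_obliqueSnd r
  have : ∫ φ in (Real.pi / 6)..(Real.pi / 3), (max 0 (1 - obliqueSnd r φ)) ^ 2 =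
      cornerPrimitive r α - cornerPrimitive r (Real.pi / 6) := by
    rw [← intervalIntegral.integral_add_adjacent_intervals (b := α)
      (Continuous.intervalIntegrable (by fun_prop) _ _)
      (Continuous.intervalIntegrable (by fun_prop) _ _), ← integral_corner]
    have hz : ∫ φ in α..(Real.pi / 3), (max 0 (1 - obliqueSnd r φ)) ^ 2 = 0 := by
      rw [intervalIntegral.integral_congr (g := fun _ => 0)]
      · simp
      · intro φ hφ
        rw [Set.uIcc_of_le hα2] at hφ
        have : 1 ≤ obliqueSnd r φ := by
          rw [obliqueSnd_eq]
          calc 1 = 2 / √3 * r * Real.sin α := by rw [hsin]; field_simp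
            _ ≤ 2 / √3 * r * Real.sin φ := by
              gcongr
              exact Real.sin_le_sin_of_le_of_le_pi_div_two (by linarith)
                (by linarith [hφ.2]) hφ.1
        simp only
        rw [max_eq_left (by linarith)]
        simp
    rw [hz, add_zero]
    refine intervalIntegral.integral_congr fun φ hφ => ?_
    rw [Set.uIcc_of_le hα1] at hφ
    have : obliqueSnd r φ ≤ 1 := by
      rw [obliqueSnd_eq]
      calc 2 / √3 * r * Real.sin φ ≤ 2 / √3 * r * Real.sin α := by
            gcongr
            exact Real.sin_le_sin_of_le_of_le_pi_div_two (by linarith [hφ.1])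
                (by linarith) hφ.2
        _ = 1 := by rw [hsin]; field_simp
    rw [max_eq_right (by linarith)]
  rw [sectorIntegral_eq_of_le_sqrt_three hr.le hr3, this]
  simp only [hexPDF₂, sectorPrimitive, cornerPrimitive, Real.sin_pi_div_three,
    Real.cos_pi_div_three, Real.sin_pi_div_six, Real.cos_pi_div_six, hsin, hcos, ← hα]
  generalize √(4 * r ^ 2 - 3) = w at *
  clear_value α
  field_simp
  generalize √(3 : ℝ) = q at *
  grind

/-- On the boundary `a + b = 2` the quadratic branch also vanishes, because `a ≤ b` forces `b ≥ 1`.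
-/
theorem sectorArea_eq_zero {a b : ℝ} (hab : a ≤ b) (h : 2 ≤ a + b) : sectorArea a b = 0 := by
  unfold sectorArea
  split_ifs with h2
  · have : 2 - a - b = 0 := by linarith
    rw [this, max_eq_left (by linarith)]
    simp
  · rfl

/-- Now `b ≥ 1` in every direction, so the corner term is absent, while `a + b ≥ 2` kills the
directions `φ ≤ ψ`. -/
theorem hexPDF₃_eq {r : ℝ} (hr3 : √3 ≤ r) (hr2 : r ≤ 2) :
    hexPDF₃ r = 8 * √3 / 9 * r * sectorIntegral r := by
  have hs := sq_sqrt_three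
  have hpi := Real.pi_pos
  have h3 : 0 < √(3 : ℝ) := by positivity
  have hr : 0 < r := by linarith
  set β := Real.arcsin (√3 / r) with hβ
  have hle : √3 / r ≤ 1 := by rw [div_le_one hr]; exact hr3
  have h0 : 0 ≤ √3 / r := by positivity
  have hsin : Real.sin β = √3 / r := Real.sin_arcsin (by linarith) (by linarith)
  have hcos : Real.cos β = √(r ^ 2 - 3) / r := by
    have hx : 1 - (√3 / r) ^ 2 = (r ^ 2 - 3) / r ^ 2 := by
      field_simp
      generalize √(3 : ℝ) = q at *
      grind
    rw [hβ, Real.cos_arcsin, hx, Real.sqrt_div' _ (sq_nonneg _), Real.sqrt_sq hr.le]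
  have hβ1 : Real.pi / 3 ≤ β := by
    rw [← arcsin_sqrt_three_div_two]
    exact Real.monotone_arcsin (by gcongr)
  have hβ2 : β ≤ Real.pi / 2 := Real.arcsin_le_pi_div_two _
  have hcont := continuous_obliqueSnd r
  have hcont' := continuous_obliqueFst r
  -- The direction in the sector with `a + b = 2`. Writing the sine at `2π/3 - φ`, which stays in
  -- `[π/3, π/2]`, makes it monotone in `φ`.
  set ψ := 2 * Real.pi / 3 - β with hψ
  have hsinψ : Real.sin ψ = √3 / 2 * Real.cos β + 1 / 2 * Real.sin β := by
    have : ψ = Real.pi - (Real.pi / 3 + β) := by rw [hψ]; ring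
    rw [this, Real.sin_pi_sub, Real.sin_add, Real.sin_pi_div_three, Real.cos_pi_div_three]
  have hcosψ : Real.cos ψ = √3 / 2 * Real.sin β - 1 / 2 * Real.cos β := by
    have : ψ = Real.pi - (Real.pi / 3 + β) := by rw [hψ]; ring
    rw [this, Real.cos_pi_sub, Real.cos_add, Real.sin_pi_div_three, Real.cos_pi_div_three]
    ring
  have hsum : ∀ φ, obliqueFst r φ + obliqueSnd r φ =
      2 / √3 * r * Real.sin (2 * Real.pi / 3 - φ) := by
    intro φ
    rw [obliqueFst_add_obliqueSnd, ← Real.sin_pi_sub]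
    congr 2
    ring
  have htwo : 2 / √3 * r * Real.sin β = 2 := by rw [hsin]; field_simp
  have hlow : Set.EqOn (fun φ => sectorArea (obliqueFst r φ) (obliqueSnd r φ)) (fun _ => 0)
      (Set.uIcc (Real.pi / 6) ψ) := by
    intro φ hφ
    rw [Set.uIcc_of_le (by linarith)] at hφ
    refine sectorArea_eq_zero (oblique_mem_sector hr.le ⟨hφ.1, by linarith [hφ.2]⟩).2 ?_
    rw [hsum]
    refine htwo.symm.le.trans ?_
    gcongr
    exact Real.sin_le_sin_of_le_of_le_pi_div_two (by linarith) (by linarith [hφ.1])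
      (by linarith [hφ.2])
  have hhigh : Set.EqOn (fun φ => sectorArea (obliqueFst r φ) (obliqueSnd r φ))
      (fun φ => (2 - obliqueSnd r φ) * (2 - obliqueFst r φ - obliqueSnd r φ))
      (Set.uIcc ψ (Real.pi / 3)) := by
    intro φ hφ
    rw [Set.uIcc_of_le (by linarith)] at hφ
    have h1 : obliqueFst r φ + obliqueSnd r φ ≤ 2 := by
      rw [hsum]
      refine le_trans ?_ htwo.le
      gcongr
      exact Real.sin_le_sin_of_le_of_le_pi_div_two (by linarith [hφ.2]) (by linarith)
        (by linarith [hφ.1])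
    have h2 : 1 ≤ obliqueSnd r φ := by
      rw [obliqueSnd_eq]
      calc 1 = 2 / √3 * √3 * (1 / 2) := by field_simp
        _ ≤ 2 / √3 * r * Real.sin φ := by
          rw [← Real.sin_pi_div_six]
          gcongr
          · rw [Real.sin_pi_div_six]; norm_num
          · exact Real.sin_le_sin_of_le_of_le_pi_div_two (by linarith) (by linarith [hφ.2])
              (by linarith [hφ.1])
    simp only [sectorArea, h1, if_true]
    rw [max_eq_left (by linarith)]
    ring
  have hint : sectorIntegral r = sectorPrimitive r (Real.pi / 3) - sectorPrimitive r ψ := by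
    rw [← integral_sector, ← intervalIntegral.integral_congr hhigh, sectorIntegral,
      ← intervalIntegral.integral_add_adjacent_intervals (b := ψ),
      intervalIntegral.integral_congr hlow]
    · simp
    · exact (intervalIntegrable_congr (hlow.mono Set.uIoc_subset_uIcc)).2 intervalIntegrable_const
    · exact (intervalIntegrable_congr (hhigh.mono Set.uIoc_subset_uIcc)).2
        (Continuous.intervalIntegrable (by fun_prop) _ _)
  rw [hint]
  simp only [hexPDF₃, sectorPrimitive, Real.sin_pi_div_three,
    Real.cos_pi_div_three, hsinψ, hcosψ, hsin, hcos, ← hβ]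
  have hw : √(r ^ 2 - 3) ^ 2 = r ^ 2 - 3 := Real.sq_sqrt (by nlinarith)
  rw [hψ]
  generalize √(r ^ 2 - 3) = w at *
  clear_value β
  field_simp
  generalize √(3 : ℝ) = q at *
  grind

theorem sectorIntegral_eq_zero {r : ℝ} (hr : 2 ≤ r) : sectorIntegral r = 0 := by
  have hpi := Real.pi_pos
  rw [sectorIntegral, intervalIntegral.integral_congr (g := fun _ => 0)]
  · simp
  · intro φ hφ
    rw [Set.uIcc_of_le (by linarith)] at hφ
    refine sectorArea_eq_zero (oblique_mem_sector (by linarith) hφ).2 ?_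
    rw [obliqueFst_add_obliqueSnd, ← Real.sin_pi_sub]
    calc (2 : ℝ) = 2 / √3 * 2 * (√3 / 2) := by field_simp
      _ ≤ _ := by
        rw [← Real.sin_pi_div_three]
        gcongr
        · rw [Real.sin_pi_div_three]; positivity
        · exact Real.sin_le_sin_of_le_of_le_pi_div_two (by linarith) (by linarith [hφ.1])
              (by linarith [hφ.2])

theorem hexPDF_eq {r : ℝ} (hr : 0 ≤ r) : hexPDF r = 8 * √3 / 9 * r * sectorIntegral r := by
  unfold hexPDF
  split_ifs with h0 h1 h2 h3
  · linarith
  · exact hexPDF₁_eq hr h1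
  · exact hexPDF₂_eq (by linarith) h2
  · exact hexPDF₃_eq (by linarith) h3
  · rw [sectorIntegral_eq_zero (by linarith), mul_zero]

theorem sectorArea_nonneg {a b : ℝ} (ha : 0 ≤ a) (hab : a ≤ b) : 0 ≤ sectorArea a b := by
  unfold sectorArea
  split_ifs with h
  · rcases le_total b 1 with hb | hb
    · rw [max_eq_right (by linarith)]
      nlinarith
    · rw [max_eq_left (by linarith)]
      nlinarith [mul_nonneg (by linarith : 0 ≤ 2 - b) (by linarith : 0 ≤ 2 - a - b)]
  · exact le_rfl

theorem sectorIntegral_nonneg {r : ℝ} (hr : 0 ≤ r) : 0 ≤ sectorIntegral r := by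
  have hpi := Real.pi_pos
  exact intervalIntegral.integral_nonneg (by linarith) fun φ hφ =>
    sectorArea_nonneg (oblique_mem_sector hr hφ).1 (oblique_mem_sector hr hφ).2

theorem hexPDF_nonneg (d : ℝ) : 0 ≤ hexPDF d := by
  rcases lt_or_ge d 0 with hd | hd
  · simp [hexPDF, hd]
  · rw [hexPDF_eq hd]
    have := sectorIntegral_nonneg hd
    positivity

/-! ### Continuity and differentiation of piecewise functions. -/

theorem continuousOn_Ici_union {f : ℝ → ℝ} {a b : ℝ} (hab : a ≤ b)
    (h1 : ContinuousOn f (Set.Icc a b)) (h2 : ContinuousOn f (Set.Ici b)) :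
    ContinuousOn f (Set.Ici a) := by
  rw [← Set.Icc_union_Ici_eq_Ici hab]
  exact h1.union_of_isClosed h2 isClosed_Icc isClosed_Ici

theorem one_lt_sqrt_three : (1 : ℝ) < √3 := Real.lt_sqrt_of_sq_lt (by norm_num)

theorem sqrt_three_lt_two : √3 < (2 : ℝ) := (Real.sqrt_lt' (by norm_num)).2 (by norm_num)

/-- A function glued from five pieces with the break points of the hexagon distance. -/
noncomputable def fivePieces (c₀ : ℝ) (f₁ f₂ f₃ : ℝ → ℝ) (c₄ : ℝ) (d : ℝ) : ℝ :=
  if d < 0 then c₀ else if d ≤ 1 then f₁ d else if d ≤ √3 then f₂ d else if d ≤ 2 then f₃ d else c₄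

theorem continuous_fivePieces {c₀ c₄ : ℝ} {f₁ f₂ f₃ : ℝ → ℝ} (h0 : f₁ 0 = c₀)
    (h1 : f₁ 1 = f₂ 1) (h2 : f₂ √3 = f₃ √3) (h3 : f₃ 2 = c₄)
    (hf₁ : ContinuousOn f₁ (Set.Icc 0 1)) (hf₂ : ContinuousOn f₂ (Set.Icc 1 √3))
    (hf₃ : ContinuousOn f₃ (Set.Icc √3 2)) : Continuous (fivePieces c₀ f₁ f₂ f₃ c₄) := by
  have l1 := one_lt_sqrt_three
  have l2 := sqrt_three_lt_two
  have g1 : Set.EqOn (fivePieces c₀ f₁ f₂ f₃ c₄) (fun _ => c₀) (Set.Iic 0) := by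
    intro d hd
    rcases (Set.mem_Iic.1 hd).lt_or_eq with h | rfl
    · simp [fivePieces, h]
    · simp [fivePieces, h0]
  have g2 : Set.EqOn (fivePieces c₀ f₁ f₂ f₃ c₄) f₁ (Set.Icc 0 1) := by
    rintro d ⟨ha, hb⟩
    simp [fivePieces, hb, not_lt.2 ha]
  have g3 : Set.EqOn (fivePieces c₀ f₁ f₂ f₃ c₄) f₂ (Set.Icc 1 √3) := by
    rintro d ⟨ha, hb⟩
    rcases ha.lt_or_eq with h | rfl
    · simp [fivePieces, hb, not_le.2 h, not_lt.2 (zero_le_one.trans ha)]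
    · simp [fivePieces, not_lt.2 (zero_le_one (α := ℝ)), h1]
  have g4 : Set.EqOn (fivePieces c₀ f₁ f₂ f₃ c₄) f₃ (Set.Icc √3 2) := by
    rintro d ⟨ha, hb⟩
    have hd1 : 1 < d := by linarith
    have hd0 : ¬ d < 0 := by linarith
    rcases ha.lt_or_eq with h | rfl
    · simp [fivePieces, hb, not_le.2 h, not_le.2 hd1, hd0]
    · simp [fivePieces, not_le.2 hd1, h2]
  have g5 : Set.EqOn (fivePieces c₀ f₁ f₂ f₃ c₄) (fun _ => c₄) (Set.Ici 2) := by
    intro d hd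
    have hd : 2 ≤ d := hd
    have hd1 : ¬ d ≤ 1 := by linarith
    have hd0 : ¬ d < 0 := by linarith
    have hd3 : ¬ d ≤ √3 := by linarith
    rcases hd.lt_or_eq with h | rfl
    · simp [fivePieces, not_le.2 h, hd1, hd0, hd3]
    · simp [fivePieces, hd3, h3]
  rw [← continuousOn_univ, ← Set.Iic_union_Ici (a := (0 : ℝ))]
  refine (continuousOn_const.congr g1).union_of_isClosed ?_ isClosed_Iic isClosed_Ici
  exact continuousOn_Ici_union zero_le_one (hf₁.congr g2) (continuousOn_Ici_union l1.le
    (hf₂.congr g3) (continuousOn_Ici_union l2.le (hf₃.congr g4) (continuousOn_const.congr g5)))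

/-- Away from the break points a single branch is active on a neighbourhood, so one-sided
derivatives never need to be compared. -/
theorem hasDerivAt_fivePieces {c₀ c₄ : ℝ} {f₁ f₂ f₃ g₁ g₂ g₃ : ℝ → ℝ}
    (hf₁ : ∀ d ∈ Set.Ioo (0 : ℝ) 1, HasDerivAt f₁ (g₁ d) d)
    (hf₂ : ∀ d ∈ Set.Ioo 1 √3, HasDerivAt f₂ (g₂ d) d)
    (hf₃ : ∀ d ∈ Set.Ioo √3 2, HasDerivAt f₃ (g₃ d) d) {d : ℝ}
    (hd : d ∉ ({0, 1, √3, 2} : Set ℝ)) :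
    HasDerivAt (fivePieces c₀ f₁ f₂ f₃ c₄) (fivePieces 0 g₁ g₂ g₃ 0 d) d := by
  have l1 := one_lt_sqrt_three
  have l2 := sqrt_three_lt_two
  simp only [Set.mem_insert_iff, Set.mem_singleton_iff, not_or] at hd
  obtain ⟨h0, h1, h2, h3⟩ := hd
  rcases lt_or_gt_of_ne h0 with h0 | h0
  · have : fivePieces 0 g₁ g₂ g₃ 0 d = 0 := by simp [fivePieces, h0]
    rw [this]
    refine (hasDerivAt_const d c₀).congr_of_eventuallyEq ?_
    filter_upwards [eventually_lt_nhds h0] with e he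
    simp [fivePieces, he]
  rcases lt_or_gt_of_ne h1 with h1 | h1
  · have : fivePieces 0 g₁ g₂ g₃ 0 d = g₁ d := by simp [fivePieces, h0.le.not_gt, h1.le]
    rw [this]
    refine (hf₁ d ⟨h0, h1⟩).congr_of_eventuallyEq ?_
    filter_upwards [eventually_lt_nhds h1, eventually_gt_nhds h0] with e he he0
    simp [fivePieces, he.le, he0.le.not_gt]
  rcases lt_or_gt_of_ne h2 with h2 | h2
  · have : fivePieces 0 g₁ g₂ g₃ 0 d = g₂ d := by
      simp [fivePieces, h0.le.not_gt, h1.not_ge, h2.le]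
    rw [this]
    refine (hf₂ d ⟨h1, h2⟩).congr_of_eventuallyEq ?_
    filter_upwards [eventually_lt_nhds h2, eventually_gt_nhds h0, eventually_gt_nhds h1]
      with e he he0 he1
    simp [fivePieces, he.le, he0.le.not_gt, he1.not_ge]
  rcases lt_or_gt_of_ne h3 with h3 | h3
  · have : fivePieces 0 g₁ g₂ g₃ 0 d = g₃ d := by
      simp [fivePieces, h0.le.not_gt, h1.not_ge, h2.not_ge, h3.le]
    rw [this]
    refine (hf₃ d ⟨h2, h3⟩).congr_of_eventuallyEq ?_
    filter_upwards [eventually_lt_nhds h3, eventually_gt_nhds h0, eventually_gt_nhds h1,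
      eventually_gt_nhds h2] with e he he0 he1 he2
    simp [fivePieces, he.le, he0.le.not_gt, he1.not_ge, he2.not_ge]
  · have : fivePieces 0 g₁ g₂ g₃ 0 d = 0 := by
      simp [fivePieces, h0.le.not_gt, h1.not_ge, h2.not_ge, h3.not_ge]
    rw [this]
    refine (hasDerivAt_const d c₄).congr_of_eventuallyEq ?_
    filter_upwards [eventually_gt_nhds h3, eventually_gt_nhds h0, eventually_gt_nhds h1,
      eventually_gt_nhds h2] with e he he0 he1 he2
    simp [fivePieces, he.not_ge, he0.le.not_gt, he1.not_ge, he2.not_ge]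

theorem hexPDF_eq_fivePieces : hexPDF = fivePieces 0 hexPDF₁ hexPDF₂ hexPDF₃ 0 := rfl

theorem hexCDF_eq_fivePieces : hexCDF = fivePieces 0 hexCDF₁ hexCDF₂ hexCDF₃ 1 := rfl

theorem continuous_hexPDF : Continuous hexPDF := by
  obtain ⟨h0, h1, h2, h3⟩ := hexPDF_pieces_agree
  rw [hexPDF_eq_fivePieces]
  refine continuous_fivePieces h0 h1 h2 h3 ?_ ?_ ?_
  · unfold hexPDF₁; fun_prop
  · unfold hexPDF₂
    have : ContinuousOn (fun d : ℝ => Real.arcsin (√3 / (2 * d))) (Set.Icc 1 √3) :=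
      Real.continuous_arcsin.comp_continuousOn (continuousOn_const.div (by fun_prop)
        fun d hd => by linarith [hd.1])
    fun_prop
  · unfold hexPDF₃
    have : ContinuousOn (fun d : ℝ => Real.arcsin (√3 / d)) (Set.Icc √3 2) :=
      Real.continuous_arcsin.comp_continuousOn (continuousOn_const.div (by fun_prop)
        fun d hd => by linarith [hd.1, one_lt_sqrt_three])
    fun_prop

theorem continuous_hexCDF : Continuous hexCDF := by
  obtain ⟨h0, h1, h2, h3⟩ := hexCDF_pieces_agree
  rw [hexCDF_eq_fivePieces]
  refine continuous_fivePieces h0 h1 h2 h3 ?_ ?_ ?_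
  · unfold hexCDF₁; fun_prop
  · unfold hexCDF₂
    have : ContinuousOn (fun d : ℝ => Real.arcsin (√3 / (2 * d))) (Set.Icc 1 √3) :=
      Real.continuous_arcsin.comp_continuousOn (continuousOn_const.div (by fun_prop)
        fun d hd => by linarith [hd.1])
    fun_prop
  · unfold hexCDF₃
    have : ContinuousOn (fun d : ℝ => Real.arcsin (√3 / d)) (Set.Icc √3 2) :=
      Real.continuous_arcsin.comp_continuousOn (continuousOn_const.div (by fun_prop)
        fun d hd => by linarith [hd.1, one_lt_sqrt_three])
    fun_prop

/-! ### The distribution function is the primitive of the density. -/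

theorem hasDerivAt_arcsin_div {k d : ℝ} (hk : 0 < k) (hd : k < d) :
    HasDerivAt (fun x => Real.arcsin (k / x)) (-(k / (d * √(d ^ 2 - k ^ 2)))) d := by
  have hd0 : 0 < d := hk.trans hd
  have h1 : k / d < 1 := (div_lt_one hd0).2 hd
  have h0 : 0 < k / d := by positivity
  have h2 : 0 < d ^ 2 - k ^ 2 := by nlinarith
  have hx : 1 - (k / d) ^ 2 = (d ^ 2 - k ^ 2) / d ^ 2 := by field_simp
  have := (Real.hasDerivAt_arcsin (by linarith : k / d ≠ -1) h1.ne).comp d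
    ((hasDerivAt_inv hd0.ne').const_mul k)
  refine (this.congr_deriv ?_).congr_of_eventuallyEq (.of_forall fun x => ?_)
  · have : 0 < √(d ^ 2 - k ^ 2) := Real.sqrt_pos.2 h2
    rw [hx, Real.sqrt_div' _ (sq_nonneg _), Real.sqrt_sq hd0.le]
    field_simp
  · simp [div_eq_mul_inv]

theorem hasDerivAt_hexCDF₁ (d : ℝ) : HasDerivAt hexCDF₁ (hexPDF₁ d) d := by
  have := (((hasDerivAt_pow 4 d).const_mul (1 / 3 * (1 / 3 - Real.pi / (9 * √3)))).sub
    ((hasDerivAt_pow 3 d).const_mul (16 / 27))).add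
    ((hasDerivAt_pow 2 d).const_mul (2 * Real.pi / (3 * √3)))
  refine this.congr_deriv ?_
  unfold hexPDF₁
  push_cast
  ring

theorem hasDerivAt_hexCDF₂ {d : ℝ} (hd : 1 < d) : HasDerivAt hexCDF₂ (hexPDF₂ d) d := by
  have hs := sq_sqrt_three
  have h3 : 0 < √(3 : ℝ) := by positivity
  have hpos : 0 < 4 * d ^ 2 - 3 := by nlinarith
  have hd2 : √3 / 2 < d := by linarith [sqrt_three_lt_two]
  have hsq : √(d ^ 2 - (√3 / 2) ^ 2) = √(4 * d ^ 2 - 3) / 2 := by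
    have : d ^ 2 - (√3 / 2) ^ 2 = (4 * d ^ 2 - 3) / 2 ^ 2 := by
      rw [div_pow, Real.sq_sqrt (by norm_num)]; ring
    rw [this, Real.sqrt_div' _ (sq_nonneg _), Real.sqrt_sq (by norm_num)]
  have ha := hasDerivAt_arcsin_div (by positivity : 0 < √3 / 2) hd2
  rw [hsq] at ha
  have he : (fun x => Real.arcsin (√3 / 2 / x)) = fun x => Real.arcsin (√3 / (2 * x)) := by
    simp only [div_div]
  rw [he] at ha
  have hw := (((hasDerivAt_pow 2 d).const_mul 4).sub_const 3).sqrt hpos.ne'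
  have h4 := hasDerivAt_pow 4 d
  have h2 := hasDerivAt_pow 2 d
  have := (((((((h4.div_const 3).add h2).const_mul (-(4 / (3 * √3)))).mul ha).add
    (h4.const_mul (Real.pi / (9 * √3)))).add (h2.const_mul (10 * Real.pi / (9 * √3)))).sub
    ((((h2.const_mul 26).add_const 3).div_const 54).mul hw)).add_const (1 / 18)
  refine this.congr_deriv ?_
  unfold hexPDF₂
  have hwp : 0 < √(4 * d ^ 2 - 3) := Real.sqrt_pos.2 hpos
  have hw2 : √(4 * d ^ 2 - 3) ^ 2 = 4 * d ^ 2 - 3 := Real.sq_sqrt hpos.le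
  simp only [Pi.add_apply]
  push_cast
  clear this ha he hw hsq
  generalize √(4 * d ^ 2 - 3) = w at *
  generalize Real.arcsin (√3 / (2 * d)) = α at *
  field_simp
  generalize √(3 : ℝ) = q at *
  grind

theorem hasDerivAt_hexCDF₃ {d : ℝ} (hd : √3 < d) : HasDerivAt hexCDF₃ (hexPDF₃ d) d := by
  have hs := sq_sqrt_three
  have h3 : 0 < √(3 : ℝ) := by positivity
  have hpos : 0 < d ^ 2 - 3 := by nlinarith
  have hd0 : 0 < d := h3.trans hd
  have ha := hasDerivAt_arcsin_div h3 hd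
  rw [Real.sq_sqrt (by norm_num)] at ha
  have hw := ((hasDerivAt_pow 2 d).sub_const 3).sqrt hpos.ne'
  have h4 := hasDerivAt_pow 4 d
  have h2 := hasDerivAt_pow 2 d
  have := (((((((h4.div_const 3).add (h2.const_mul 8)).const_mul (2 / (3 * √3))).mul ha).sub
    (h4.const_mul (2 * Real.pi / (27 * √3) + 1 / 9))).sub
    (h2.const_mul (16 * Real.pi / (9 * √3) + 4 / 3))).add
    ((((h2.const_mul 14).add_const 12).div_const 9).mul hw)).add_const (5 / 9)
  refine this.congr_deriv ?_
  unfold hexPDF₃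
  have hwp : 0 < √(d ^ 2 - 3) := Real.sqrt_pos.2 hpos
  have hw2 : √(d ^ 2 - 3) ^ 2 = d ^ 2 - 3 := Real.sq_sqrt hpos.le
  simp only [Pi.add_apply]
  push_cast
  clear this ha hw
  generalize √(d ^ 2 - 3) = w at *
  generalize Real.arcsin (√3 / d) = α at *
  field_simp
  generalize √(3 : ℝ) = q at *
  grind

/-- The fundamental theorem of calculus tolerates a countable exceptional set for a continuous
primitive. This covers the break points, including `√3`, where the `arcsin (√3 / d)` of the third
piece reaches the singular argument `1`. -/
theorem integral_hexPDF (p q : ℝ) : ∫ x in p..q, hexPDF x = hexCDF q - hexCDF p := by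
  refine integral_eq_of_hasDerivAt_off_countable hexCDF hexPDF (s := {0, 1, √3, 2})
    (Set.toFinite _).countable continuous_hexCDF.continuousOn (fun d hd => ?_)
    (continuous_hexPDF.intervalIntegrable _ _)
  rw [hexCDF_eq_fivePieces, hexPDF_eq_fivePieces]
  exact hasDerivAt_fivePieces (fun d _ => hasDerivAt_hexCDF₁ d)
    (fun d hd => hasDerivAt_hexCDF₂ hd.1) (fun d hd => hasDerivAt_hexCDF₃ hd.1) hd.2

theorem hexPDF_eq_zero_of_nonpos {d : ℝ} (hd : d ≤ 0) : hexPDF d = 0 := by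
  rcases hd.lt_or_eq with h | rfl
  · simp [hexPDF, h]
  · simp [hexPDF, hexPDF₁]

theorem hexCDF_eq_zero_of_nonpos {d : ℝ} (hd : d ≤ 0) : hexCDF d = 0 := by
  rcases hd.lt_or_eq with h | rfl
  · simp [hexCDF, h]
  · simp [hexCDF, hexCDF₁]

theorem setLIntegral_Iic_hexPDF (d : ℝ) :
    ∫⁻ x in Set.Iic d, ENNReal.ofReal (hexPDF x) = ENNReal.ofReal (hexCDF d) := by
  have hz : ∀ e ≤ (0 : ℝ), ∫⁻ x in Set.Iic e, ENNReal.ofReal (hexPDF x) = 0 := by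
    intro e he
    rw [setLIntegral_congr_fun (g := 0) measurableSet_Iic]
    · simp
    · intro x hx
      simp [hexPDF_eq_zero_of_nonpos ((Set.mem_Iic.1 hx).trans he)]
  rcases le_total d 0 with hd | hd
  · rw [hz d hd, hexCDF_eq_zero_of_nonpos hd, ENNReal.ofReal_zero]
  · rw [← Set.Iic_union_Ioc_eq_Iic hd, lintegral_union measurableSet_Ioc
      (Set.Iic_disjoint_Ioc le_rfl), hz 0 le_rfl, zero_add, ← ofReal_integral_eq_lintegral_ofReal
      (continuous_hexPDF.integrableOn_Ioc) (.of_forall hexPDF_nonneg),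
      ← intervalIntegral.integral_of_le hd, integral_hexPDF, hexCDF_eq_zero_of_nonpos le_rfl,
      sub_zero]

theorem hexCDF_nonneg (d : ℝ) : 0 ≤ hexCDF d := by
  rcases le_total d 0 with hd | hd
  · rw [hexCDF_eq_zero_of_nonpos hd]
  · have := integral_hexPDF 0 d
    rw [hexCDF_eq_zero_of_nonpos le_rfl, sub_zero] at this
    rw [← this]
    exact intervalIntegral.integral_nonneg hd fun x _ => hexPDF_nonneg x

/-! ### The covariogram integrated in polar coordinates. -/

theorem volume_complexHexagon : volume complexHexagon = ENNReal.ofReal (3 * √3 / 2) := by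
  have h := covariogram_complexHexagon le_rfl (le_refl (0 : ℝ))
  have h0 : (⟨0 + 0 / 2, √3 / 2 * 0⟩ : ℂ) = 0 := by
    apply Complex.ext <;> simp
  rw [h0] at h
  have h1 : covariogram complexHexagon 0 = volume complexHexagon := by simp [covariogram]
  rw [← h1, h, sectorArea]
  congr 1
  norm_num
  ring

theorem covariogram_complexHexagon_le (z : ℂ) :
    covariogram complexHexagon z ≤ ENNReal.ofReal (3 * √3 / 2) := by
  rw [← volume_complexHexagon]
  exact measure_mono fun w hw => hw.1

theorem covariogram_polar_add_pi_div_three (r φ : ℝ) :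
    covariogram complexHexagon (Complex.polarCoord.symm (r, φ + Real.pi / 3)) =
      covariogram complexHexagon (Complex.polarCoord.symm (r, φ)) := by
  rw [← covariogram_complexHexagon_rotate (Complex.polarCoord.symm (r, φ))]
  congr 1
  simp only [Complex.polarCoord_symm_apply, Circle.coe_exp]
  push_cast
  rw [← Complex.exp_mul_I, ← Complex.exp_mul_I, add_mul, Complex.exp_add]
  ring

theorem covariogram_polar_neg (r φ : ℝ) :
    covariogram complexHexagon (Complex.polarCoord.symm (r, -φ)) =
      covariogram complexHexagon (Complex.polarCoord.symm (r, φ)) := by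
  rw [← covariogram_complexHexagon_conj]
  congr 1
  apply Complex.ext <;> simp [Complex.polarCoord_symm_apply]

theorem covariogram_polar {r φ : ℝ} (hr : 0 ≤ r)
    (hφ : φ ∈ Set.Icc (Real.pi / 6) (Real.pi / 3)) :
    covariogram complexHexagon (Complex.polarCoord.symm (r, φ)) =
      ENNReal.ofReal (√3 / 2 * sectorArea (obliqueFst r φ) (obliqueSnd r φ)) := by
  obtain ⟨h1, h2⟩ := oblique_mem_sector hr hφ
  rw [← covariogram_complexHexagon h1 h2]
  congr 1
  apply Complex.ext
  · simp [Complex.polarCoord_symm_apply, obliqueFst, obliqueSnd, Complex.cos_ofReal_re]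
    ring
  · have h3 : √(3 : ℝ) ≠ 0 := by positivity
    simp [Complex.polarCoord_symm_apply, obliqueSnd, Complex.sin_ofReal_re]
    field_simp

theorem measurable_covariogram_polar :
    Measurable fun p : ℝ × ℝ => covariogram complexHexagon (Complex.polarCoord.symm p) := by
  refine (measurable_covariogram measurableSet_complexHexagon).comp ?_
  have : (fun p : ℝ × ℝ => Complex.polarCoord.symm p) =
      fun p : ℝ × ℝ => (p.1 * (Real.cos p.2 + Real.sin p.2 * Complex.I) : ℂ) :=
    funext fun p => Complex.polarCoord_symm_apply p
  change Measurable fun p : ℝ × ℝ => Complex.polarCoord.symm p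
  rw [this]
  fun_prop

/-- The circle consists of twelve copies of the sector, each contributing `√3 / 2 * sectorIntegral
r`. The boundedness of the covariogram allows the symmetry argument to be run with real interval
integrals. -/
theorem lintegral_covariogram_polar {r : ℝ} (hr : 0 ≤ r) :
    ∫⁻ φ in Set.Ioo (-Real.pi) Real.pi,
      covariogram complexHexagon (Complex.polarCoord.symm (r, φ)) =
      ENNReal.ofReal (6 * √3 * sectorIntegral r) := by
  have hpi := Real.pi_pos
  set g : ℝ → ℝ := fun φ =>
    (covariogram complexHexagon (Complex.polarCoord.symm (r, φ))).toReal with hg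
  have hfin : ∀ z, covariogram complexHexagon z ≠ ⊤ := fun z =>
    ((covariogram_complexHexagon_le z).trans_lt ENNReal.ofReal_lt_top).ne
  have hgm : Measurable g :=
    (measurable_covariogram_polar.comp measurable_prodMk_left).ennreal_toReal
  have hgb : ∀ φ, ‖g φ‖ ≤ 3 * √3 / 2 := by
    intro φ
    rw [Real.norm_of_nonneg ENNReal.toReal_nonneg]
    exact ENNReal.toReal_le_of_le_ofReal (by positivity) (covariogram_complexHexagon_le _)
  have hgi : ∀ p q : ℝ, IntervalIntegrable g volume p q := by
    intro p q
    rw [intervalIntegrable_iff]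
    exact Measure.integrableOn_of_bounded (measure_Ioc_lt_top).ne hgm.aestronglyMeasurable
      (.of_forall hgb)
  have hper : Function.Periodic g (Real.pi / 3) := fun φ => by
    simp only [hg, covariogram_polar_add_pi_div_three]
  have hneg : ∀ φ, g (-φ) = g φ := fun φ => by simp only [hg, covariogram_polar_neg]
  have h1 : ∫ φ in (-Real.pi)..Real.pi, g φ = 6 * ∫ φ in (0 : ℝ)..(Real.pi / 3), g φ := by
    have := hper.intervalIntegral_add_zsmul_eq 6 (-Real.pi) hgi
    rw [hper.intervalIntegral_add_eq (-Real.pi) 0, zero_add] at this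
    have e : -Real.pi + (6 : ℤ) • (Real.pi / 3) = Real.pi := by
      rw [zsmul_eq_mul]; push_cast; ring
    rw [e] at this
    rw [this, zsmul_eq_mul]
    norm_num
  -- Evenness and the period `π/3` together give symmetry about `φ = π/6`.
  have h2 : ∫ φ in (0 : ℝ)..(Real.pi / 6), g φ = ∫ φ in (Real.pi / 6)..(Real.pi / 3), g φ := by
    have h := intervalIntegral.integral_comp_sub_left g (a := 0) (b := Real.pi / 6) (Real.pi / 3)
    have e : ∀ φ, g (Real.pi / 3 - φ) = g φ := fun φ => by
      rw [← hneg φ, ← hper (-φ)]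
      congr 1
      ring
    simp only [e] at h
    rw [h]
    congr 1 <;> ring
  have h3 : ∫ φ in (Real.pi / 6)..(Real.pi / 3), g φ = √3 / 2 * sectorIntegral r := by
    rw [sectorIntegral, ← intervalIntegral.integral_const_mul]
    refine intervalIntegral.integral_congr fun φ hφ => ?_
    rw [Set.uIcc_of_le (by linarith)] at hφ
    simp only [hg]
    rw [covariogram_polar hr hφ, ENNReal.toReal_ofReal]
    obtain ⟨h5, h6⟩ := oblique_mem_sector hr hφ
    exact mul_nonneg (by positivity) (sectorArea_nonneg h5 h6)
  have h4 : ∫ φ in (-Real.pi)..Real.pi, g φ = 6 * √3 * sectorIntegral r := by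
    rw [h1, ← intervalIntegral.integral_add_adjacent_intervals (hgi 0 (Real.pi / 6))
      (hgi (Real.pi / 6) (Real.pi / 3)), h2, h3]
    ring
  rw [← h4, intervalIntegral.integral_of_le (by linarith), ← setLIntegral_congr Ioo_ae_eq_Ioc.symm,
    ofReal_integral_eq_lintegral_ofReal (hgi _ _).1 (.of_forall fun _ => ENNReal.toReal_nonneg)]
  exact lintegral_congr fun φ => (ENNReal.ofReal_toReal (hfin _)).symm

/-- Here `27/4` is the squared area of the hexagon, and `6√3 = (27/4) * (8√3/9)` matches the angular
integral with `hexPDF_eq`. -/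
theorem lintegral_norm_mul_covariogram {f : ℝ → ENNReal} (hf : Measurable f) :
    ∫⁻ z, f ‖z‖ * covariogram complexHexagon z =
      ENNReal.ofReal (27 / 4) * ∫⁻ r, f r * ENNReal.ofReal (hexPDF r) := by
  have hm := measurable_covariogram_polar
  have hint : Measurable fun p : ℝ × ℝ => ENNReal.ofReal p.1 *
      (f p.1 * covariogram complexHexagon (Complex.polarCoord.symm p)) := by fun_prop
  calc ∫⁻ z, f ‖z‖ * covariogram complexHexagon z
      = ∫⁻ p in polarCoord.target, ENNReal.ofReal p.1 *
          (f p.1 * covariogram complexHexagon (Complex.polarCoord.symm p)) := by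
        rw [← Complex.lintegral_comp_polarCoord_symm]
        refine setLIntegral_congr_fun polarCoord.open_target.measurableSet fun p hp => ?_
        have hp1 : 0 < p.1 := hp.1
        simp only [Complex.norm_polarCoord_symm, abs_of_pos hp1, smul_eq_mul]
    _ = ∫⁻ r in Set.Ioi 0, ∫⁻ φ in Set.Ioo (-Real.pi) Real.pi, ENNReal.ofReal r *
          (f r * covariogram complexHexagon (Complex.polarCoord.symm (r, φ))) := by
        rw [polarCoord_target, Measure.volume_eq_prod, ← Measure.prod_restrict,
          lintegral_prod _ hint.aemeasurable]
    _ = ∫⁻ r in Set.Ioi 0, ENNReal.ofReal (27 / 4) * (f r * ENNReal.ofReal (hexPDF r)) := by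
        refine setLIntegral_congr_fun measurableSet_Ioi fun r hr => ?_
        have hr0 : 0 ≤ r := le_of_lt hr
        have hmr : Measurable fun φ =>
            covariogram complexHexagon (Complex.polarCoord.symm (r, φ)) :=
          hm.comp measurable_prodMk_left
        have hJ := sectorIntegral_nonneg hr0
        rw [lintegral_const_mul _ (hmr.const_mul _), lintegral_const_mul _ hmr,
          lintegral_covariogram_polar hr0, mul_left_comm, mul_left_comm (ENNReal.ofReal (27 / 4)),
          ← ENNReal.ofReal_mul hr0, ← ENNReal.ofReal_mul (by norm_num), hexPDF_eq hr0]
        congr 2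
        ring
    _ = ∫⁻ r, ENNReal.ofReal (27 / 4) * (f r * ENNReal.ofReal (hexPDF r)) := by
        rw [← lintegral_indicator measurableSet_Ioi]
        refine lintegral_congr fun r => ?_
        by_cases hr : 0 < r
        · simp [hr]
        · simp [hr, hexPDF_eq_zero_of_nonpos (not_lt.1 hr)]
    _ = _ := by
        have := continuous_hexPDF.measurable
        rw [lintegral_const_mul _ (by fun_prop)]

/-! ### The law of the distance. -/

theorem volume_unitHexagon (c : EuclideanSpace ℝ (Fin 2)) (θ : ℝ) :
    volume (unitHexagon c θ) = ENNReal.ofReal (3 * √3 / 2) := by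
  have h := covariogram_image_isometry (planeRotation θ) c complexHexagon 0
  rw [map_zero] at h
  rw [measure_congr (unitHexagon_ae_eq c θ), ← volume_complexHexagon]
  simpa only [covariogram, zero_add, and_self, Set.ofPred_mem_eq] using h

/-- Testing against the indicator of `B` turns the probability into the integral of a function of
`‖v‖` against the covariogram. The isometry moves it to `ℂ`, and the two normalising factors cancel
the `27/4`. -/
theorem map_dist_prod_uniform (c : EuclideanSpace ℝ (Fin 2)) (θ : ℝ) :
    ((ProbabilityTheory.cond volume (unitHexagon c θ)).prod (ProbabilityTheory.cond volume (unitHexagon c θ))).map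
      (fun p => dist p.1 p.2) = volume.withDensity (fun d => ENNReal.ofReal (hexPDF d)) := by
  set S := (fun z => c + planeRotation θ z) '' complexHexagon with hS
  have hSm : MeasurableSet S := by
    have : Topology.IsClosedEmbedding fun z => c + planeRotation θ z :=
      (Homeomorph.addLeft c).isClosedEmbedding.comp
        (planeRotation θ).toHomeomorph.isClosedEmbedding
    exact (this.isClosedMap _ isClosed_complexHexagon).measurableSet
  have hcov : ∀ z, covariogram S (planeRotation θ z) = covariogram complexHexagon z := fun z =>
    covariogram_image_isometry (planeRotation θ) c complexHexagon z
  have hcond : ProbabilityTheory.cond volume (unitHexagon c θ) =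
      (ENNReal.ofReal (3 * √3 / 2))⁻¹ • volume.restrict S := by
    rw [ProbabilityTheory.cond, volume_unitHexagon,
      Measure.restrict_congr_set (unitHexagon_ae_eq c θ)]
  have hd : Measurable fun p : EuclideanSpace ℝ (Fin 2) × EuclideanSpace ℝ (Fin 2) =>
      dist p.1 p.2 := measurable_dist
  ext B hB
  have hf : Measurable (B.indicator (1 : ℝ → ENNReal)) := measurable_one.indicator hB
  rw [Measure.map_apply hd hB, withDensity_apply _ hB, hcond, Measure.prod_smul_left,
    Measure.prod_smul_right, Measure.prod_restrict, Measure.smul_apply, Measure.smul_apply,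
    ← lintegral_indicator_one (hd hB)]
  have h1 := setLIntegral_prod_sub hSm (f := fun v => B.indicator 1 ‖v‖) (hf.comp measurable_norm)
  have h2 : ∀ p : EuclideanSpace ℝ (Fin 2) × EuclideanSpace ℝ (Fin 2),
      ((fun p => dist p.1 p.2) ⁻¹' B).indicator
          (1 : EuclideanSpace ℝ (Fin 2) × EuclideanSpace ℝ (Fin 2) → ENNReal) p =
        B.indicator 1 ‖p.1 - p.2‖ := by
    intro p
    rw [← dist_eq_norm]
    rfl
  simp only [h2]
  rw [h1, ← (planeRotation θ).measurePreserving.lintegral_comp_emb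
    (planeRotation θ).toMeasurableEquiv.measurableEmbedding]
  simp only [hcov, LinearIsometryEquiv.norm_map]
  rw [lintegral_norm_mul_covariogram hf, ← lintegral_indicator hB, smul_eq_mul, smul_eq_mul,
    ← mul_assoc, ← mul_assoc, ← ENNReal.ofReal_inv_of_pos (by positivity),
    ← ENNReal.ofReal_mul (by positivity), ← ENNReal.ofReal_mul (by positivity)]
  have hone : (3 * √3 / 2)⁻¹ * (3 * √3 / 2)⁻¹ * (27 / 4) = (1 : ℝ) := by
    have := sq_sqrt_three
    field_simp
    nlinarith
  rw [hone, ENNReal.ofReal_one, one_mul]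
  refine lintegral_congr fun r => ?_
  by_cases hr : r ∈ B <;> simp [hr]

theorem mainTheorem1 {Ω : Type*} [MeasurableSpace Ω] (P : Measure Ω) [IsProbabilityMeasure P]
    (c : EuclideanSpace ℝ (Fin 2)) (θ : ℝ)
    (X Y : Ω → EuclideanSpace ℝ (Fin 2))
    (hX : pdf.IsUniform X (unitHexagon c θ) P volume)
    (hY : pdf.IsUniform Y (unitHexagon c θ) P volume)
    (hXY : IndepFun X Y P) :
    AEMeasurable (fun ω => dist (X ω) (Y ω)) P ∧
    (∀ d : ℝ, 0 ≤ hexPDF d) ∧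
    P.map (fun ω => dist (X ω) (Y ω)) =
      volume.withDensity (fun d : ℝ => ENNReal.ofReal (hexPDF d)) ∧
    (∀ d : ℝ, P.real {ω | dist (X ω) (Y ω) ≤ d} = hexCDF d) := by
  have hV := volume_unitHexagon c θ
  have hV0 : volume (unitHexagon c θ) ≠ 0 := by
    rw [hV, ENNReal.ofReal_ne_zero_iff]
    positivity
  have hVt : volume (unitHexagon c θ) ≠ ⊤ := by
    rw [hV]
    exact ENNReal.ofReal_ne_top
  have hXm := pdf.IsUniform.aemeasurable hV0 hVt hX
  have hYm := pdf.IsUniform.aemeasurable hV0 hVt hY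
  have hD : AEMeasurable (fun ω => dist (X ω) (Y ω)) P := hXm.dist hYm
  have hmap : P.map (fun ω => dist (X ω) (Y ω)) =
      volume.withDensity (fun d : ℝ => ENNReal.ofReal (hexPDF d)) := by
    have h := (indepFun_iff_map_prod_eq_prod_map_map hXm hYm).1 hXY
    rw [hX, hY] at h
    rw [← map_dist_prod_uniform c θ, ← h, AEMeasurable.map_map_of_aemeasurable
      measurable_dist.aemeasurable (hXm.prodMk hYm)]
    rfl
  refine ⟨hD, hexPDF_nonneg, hmap, fun d => ?_⟩
  have h := Measure.map_apply_of_aemeasurable hD (measurableSet_Iic (a := d))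
  rw [hmap, withDensity_apply _ measurableSet_Iic, setLIntegral_Iic_hexPDF] at h
  change (P ((fun ω => dist (X ω) (Y ω)) ⁻¹' Set.Iic d)).toReal = hexCDF d
  rw [← h, ENNReal.toReal_ofReal (hexCDF_nonneg d)]
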